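/- There exists a universal constant $C_3>0$ such that the following holds. Let $n\ge 1$, let $\varepsilon_1,\ldots,\varepsilon_n$ be i.i.d. Rademacher random variables, i.e. independent with $\mathbb{P}(\varepsilon_i=1)=\mathbb{P}(\varepsilon_i=-1)=\frac12$, and let $a_1\ge\ldots\ge a_n\ge 0$ be real numbers with $\sum_{i=1}^n a_i^2=1$. Put $S=\sum_{i=1}^n a_i\varepsilon_i$ and $S_n=\frac{1}{\sqrt n}\sum_{i=1}^n\varepsilon_i$, and write $x_+=\max\{x,0\}$. Then $$\mathbb{E}|S|^3\le \mathbb{E}|S_n|^3-\frac{C_3}{a_1^2+\frac1n}\sum_{i=1}^n\sqrt{\frac1n\left(a_i^2+a_n^2-\frac1n\right)}\left(a_i^2-\frac1n\right)_+\left(\frac1n-a_{n+1-i}^2\right)_+ ,$$ where a summand with $a_i^2<\frac1n$ (whose square root may be undefined, but whose factor $(a_i^2-\frac1n)_+$ vanishes) is read as $0$. -/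

import Mathlib

open MeasureTheory ProbabilityTheory

/-- `X` is a Rademacher random variable on the probability space `(Ω, P)`: it is measurable and
takes each of the values `1` and `-1` with probability `1/2`. -/
structure IsRademacher {Ω : Type*} [MeasurableSpace Ω] (X : Ω → ℝ) (P : Measure Ω) : Prop where
  measurable : Measurable X
  prob_one : P {ω | X ω = 1} = 1 / 2
  prob_neg_one : P {ω | X ω = -1} = 1 / 2

/-- The Rademacher sum `∑ i, a i * ε i`. -/
def rademacherSum {Ω : Type*} {n : ℕ} (a : Fin n → ℝ) (ε : Fin n → Ω → ℝ) (ω : Ω) : ℝ :=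
  ∑ i, a i * ε i ω

/-- The normalized sum `S_n = (1 / √n) * ∑ i, ε i`. -/
noncomputable def diagonalSum {Ω : Type*} {n : ℕ} (ε : Fin n → Ω → ℝ) (ω : Ω) : ℝ :=
  (1 / Real.sqrt n) * ∑ i, ε i ω

/-- The deficit of a coefficient vector `a = (a_1, …, a_n)`, without its multiplicative constant.
With indices starting at `0`, `a 0` is `a_1`, `a (Fin.rev 0)` is `a_n`, and `a (Fin.rev i)` is the
coefficient in the position mirrored to `i`. Where the radicand is negative, the factor
`(a_i² - 1/n)_+` vanishes, so the value given to the square root there is irrelevant. -/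
noncomputable def criticalDeficit {n : ℕ} [NeZero n] (a : Fin n → ℝ) : ℝ :=
  1 / (a 0 ^ 2 + 1 / n) *
    ∑ i : Fin n, Real.sqrt (1 / n * (a i ^ 2 + a (Fin.rev 0) ^ 2 - 1 / n)) *
      max (a i ^ 2 - 1 / n) 0 * max (1 / n - a (Fin.rev i) ^ 2) 0

/-!
The deficit is controlled by a simpler quantity, which already bounds the gap between the moments:
`E|S_n|³ - E|S|³ ≥ c (∑ a_i⁴ - 1/n) = c ∑ (a_i² - 1/n)²` for a universal `c > 0`. By the inequality
of means this sum dominates the deficit (`criticalDeficit_le`).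

For the stronger inequality, regard the third moment as a function of the squares `x_i = a_i²` on
the standard simplex and maximize `E|S|³ + c ∑ x_i²` over this compact set. If the maximizer were
not constant, replacing its largest and smallest coordinates `x_i > x_j` by their average would
increase `E|S|³` by a multiple of `(x_i - x_j)²` (`signMean_cube_average`) and decrease `∑ x_i²` by
only `(x_i - x_j)² / 2`, a contradiction for small `c` (`signMean_cube_add_le`).

The gain under averaging comes from the following. Write `S = a_i ε_i + a_j ε_j + Y` and put
`u = a_i + a_j`, `v = a_i - a_j`, `w² = u² + v²`. Up to terms depending on `u² + v²` and `|Y|` only,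
the symmetrized cube is `((u - |Y|)₊³ + (v - |Y|)₊³) / 2`, and averaging replaces `(u, v)` by
`(w, 0)`. The truncated cubes are superadditive in this sense (`posPart_cube_add_le`), with a gain
of order `u² v² / w = (x_i - x_j)² / w` when `|Y| ≤ w / √2` (`posPart_cube_gap`). Since all
coefficients of `Y` are at most `w / √2`, this event has probability at least a constant times `w`
(`le_signMean_ball`), which follows from the reflection principle.
-/

/-! ### Averages over random signs -/

section SignMean

variable {ι : Type*}

/-- The expectation of `f (w + ∑ i ∈ T, a i * ε i)` for independent random signs `ε i`, as a finite
average: the subset `A` of `T` is the set of indices carrying the sign `+1`. -/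
noncomputable def signMean (a : ι → ℝ) (T : Finset ι) (f : ℝ → ℝ) (w : ℝ) : ℝ :=
  (∑ A ∈ T.powerset, f (w + 2 * ∑ i ∈ A, a i - ∑ i ∈ T, a i)) / 2 ^ T.card

variable {a : ι → ℝ} {T : Finset ι}

@[simp] lemma signMean_empty (a : ι → ℝ) (f : ℝ → ℝ) (w : ℝ) : signMean a ∅ f w = f w := by
  simp [signMean]

lemma signMean_mono {f g : ℝ → ℝ} (h : ∀ t, f t ≤ g t) (w : ℝ) :
    signMean a T f w ≤ signMean a T g w := by
  unfold signMean
  gcongr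
  exact h _

lemma signMean_add (f g : ℝ → ℝ) (w : ℝ) :
    signMean a T (fun t => f t + g t) w = signMean a T f w + signMean a T g w := by
  simp only [signMean, Finset.sum_add_distrib, add_div]

lemma signMean_const_mul (c : ℝ) (f : ℝ → ℝ) (w : ℝ) :
    signMean a T (fun t => c * f t) w = c * signMean a T f w := by
  simp only [signMean, ← Finset.mul_sum, mul_div_assoc]

lemma signMean_sum {κ : Type*} (s : Finset κ) (f : κ → ℝ → ℝ) (w : ℝ) :
    signMean a T (fun t => ∑ k ∈ s, f k t) w = ∑ k ∈ s, signMean a T (f k) w := by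
  simp only [signMean, ← Finset.sum_div]
  rw [Finset.sum_comm]

lemma signMean_const (c w : ℝ) : signMean a T (fun _ => c) w = c := by
  simp [signMean, Finset.card_powerset]

lemma signMean_translate (f : ℝ → ℝ) (u w : ℝ) :
    signMean a T (fun t => f (u + t)) w = signMean a T f (u + w) := by
  unfold signMean
  simp only [add_assoc, add_sub_assoc]

lemma signMean_congr {a' : ι → ℝ} (h : ∀ i ∈ T, a i = a' i) (f : ℝ → ℝ) (w : ℝ) :
    signMean a T f w = signMean a' T f w := by
  unfold signMean
  rw [Finset.sum_congr rfl h]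
  congr 1
  refine Finset.sum_congr rfl fun A hA => ?_
  rw [Finset.sum_congr rfl fun i hi => h i (Finset.mem_powerset.1 hA hi)]

variable [DecidableEq ι]

lemma signMean_insert {i : ι} (hi : i ∉ T) (f : ℝ → ℝ) (w : ℝ) :
    signMean a (insert i T) f w = (signMean a T f (w + a i) + signMean a T f (w - a i)) / 2 := by
  have h : ∑ A ∈ T.powerset, f (w + 2 * ∑ j ∈ insert i A, a j - (a i + ∑ j ∈ T, a j)) =
      ∑ A ∈ T.powerset, f (w + a i + 2 * ∑ j ∈ A, a j - ∑ j ∈ T, a j) := by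
    refine Finset.sum_congr rfl fun A hA => ?_
    rw [Finset.sum_insert fun h => hi (Finset.mem_powerset.1 hA h)]
    congr 1; ring
  have h' : ∑ A ∈ T.powerset, f (w + 2 * ∑ j ∈ A, a j - (a i + ∑ j ∈ T, a j)) =
      ∑ A ∈ T.powerset, f (w - a i + 2 * ∑ j ∈ A, a j - ∑ j ∈ T, a j) :=
    Finset.sum_congr rfl fun A _ => by congr 1; ring
  rw [signMean, Finset.sum_powerset_insert hi, Finset.sum_insert hi,
    Finset.card_insert_of_notMem hi, h, h', signMean, signMean, pow_succ]
  field_simp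
  ring

lemma signMean_reflect (f : ℝ → ℝ) (c w : ℝ) :
    signMean a T (fun t => f (c - t)) (c - w) = signMean a T f w := by
  induction T using Finset.induction_on generalizing w with
  | empty => simp
  | insert i T hi ih =>
    rw [signMean_insert hi, signMean_insert hi, ← ih (w + a i), ← ih (w - a i),
      show c - w + a i = c - (w - a i) by ring, show c - w - a i = c - (w + a i) by ring, add_comm]

lemma signMean_sq (w : ℝ) : signMean a T (fun t => t ^ 2) w = w ^ 2 + ∑ i ∈ T, a i ^ 2 := by
  induction T using Finset.induction_on generalizing w with
  | empty => simp
  | insert i T hi ih =>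
    rw [signMean_insert hi, ih, ih, Finset.sum_insert hi]
    ring

lemma IsRademacher.ae_eq {Ω : Type*} [MeasurableSpace Ω] {P : Measure Ω} [IsProbabilityMeasure P]
    {X : Ω → ℝ} (hX : IsRademacher X P) : ∀ᵐ ω ∂P, X ω = 1 ∨ X ω = -1 := by
  have h1 : MeasurableSet {ω | X ω = 1} := hX.measurable (measurableSet_singleton 1)
  have h2 : MeasurableSet {ω | X ω = -1} := hX.measurable (measurableSet_singleton (-1))
  have hd : Disjoint {ω | X ω = 1} {ω | X ω = -1} := by
    rw [Set.disjoint_left]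
    intro ω h h'
    simp only [Set.mem_ofPred_eq] at h h'
    linarith
  have : P ({ω | X ω = 1} ∪ {ω | X ω = -1}) = 1 := by
    rw [measure_union hd h2, hX.prob_one, hX.prob_neg_one, ENNReal.add_halves]
  exact (prob_compl_eq_zero_iff (h1.union h2)).2 this

/-- Functions of a Rademacher sum are integrable, with integral the average over signs. -/
lemma integral_rademacher {Ω : Type*} [MeasurableSpace Ω] {P : Measure Ω} [IsProbabilityMeasure P]
    {ε : ι → Ω → ℝ} (hε : ∀ i, IsRademacher (ε i) P) (hind : iIndepFun ε P) (a : ι → ℝ)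
    (T : Finset ι) {f : ℝ → ℝ} (hf : Measurable f) (w : ℝ) :
    Integrable (fun ω => f (w + ∑ i ∈ T, a i * ε i ω)) P ∧
      ∫ ω, f (w + ∑ i ∈ T, a i * ε i ω) ∂P = signMean a T f w := by
  induction T using Finset.induction_on generalizing w with
  | empty => simp
  | insert i T hi ih =>
    have key : ∀ c v : ℝ, P {ω | ε i ω = c} = 1 / 2 →
        Integrable (fun ω => ({c} : Set ℝ).indicator 1 (ε i ω) *
          f (v + ∑ j ∈ T, a j * ε j ω)) P ∧
        ∫ ω, ({c} : Set ℝ).indicator 1 (ε i ω) * f (v + ∑ j ∈ T, a j * ε j ω) ∂P =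
          1 / 2 * signMean a T f v := by
      intro c v hc
      have hφ : Measurable (({c} : Set ℝ).indicator (1 : ℝ → ℝ)) :=
        measurable_one.indicator (measurableSet_singleton c)
      have hφ' : ∀ ω, ({c} : Set ℝ).indicator (1 : ℝ → ℝ) (ε i ω) =
          {ω | ε i ω = c}.indicator 1 ω := fun ω => by
        simp [Set.indicator]
      have hm : MeasurableSet {ω | ε i ω = c} :=
        (hε i).measurable (measurableSet_singleton c)
      have hI := (hind.indepFun_finset {i} T (by simpa using hi)
        fun j => (hε j).measurable).comp
        (φ := fun z => ({c} : Set ℝ).indicator (1 : ℝ → ℝ) (z ⟨i, Finset.mem_singleton_self i⟩))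
        (ψ := fun z => f (v + ∑ j : T, a j * z j))
        (by fun_prop) (by fun_prop)
      have hψ : ∀ ω, ∑ j : T, a j * ε j ω = ∑ j ∈ T, a j * ε j ω := fun ω =>
        Finset.sum_coe_sort T fun j => a j * ε j ω
      have hI' : IndepFun (fun ω => ({c} : Set ℝ).indicator (1 : ℝ → ℝ) (ε i ω))
          (fun ω => f (v + ∑ j ∈ T, a j * ε j ω)) P := by
        simpa only [Function.comp_def, hψ] using hI
      have hint : Integrable (fun ω => ({c} : Set ℝ).indicator (1 : ℝ → ℝ) (ε i ω)) P := by
        simp only [hφ']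
        exact (integrable_const (1 : ℝ)).indicator hm
      refine ⟨hI'.integrable_mul hint (ih v).1, ?_⟩
      rw [hI'.integral_fun_mul_eq_mul_integral hint.aestronglyMeasurable
        (ih v).1.aestronglyMeasurable, (ih v).2]
      simp only [hφ']
      rw [integral_indicator_one hm, Measure.real, hc]
      simp
    have hsplit : (fun ω => f (w + ∑ j ∈ insert i T, a j * ε j ω)) =ᵐ[P] fun ω =>
        ({1} : Set ℝ).indicator 1 (ε i ω) * f (w + a i + ∑ j ∈ T, a j * ε j ω) +
        ({-1} : Set ℝ).indicator 1 (ε i ω) * f (w - a i + ∑ j ∈ T, a j * ε j ω) := by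
      filter_upwards [(hε i).ae_eq] with ω hω
      rw [Finset.sum_insert hi]
      rcases hω with h | h <;> norm_num [h, Set.indicator] <;> congr 1 <;> ring
    obtain ⟨i1, e1⟩ := key 1 (w + a i) (hε i).prob_one
    obtain ⟨i2, e2⟩ := key (-1) (w - a i) (hε i).prob_neg_one
    refine ⟨(i1.add i2).congr hsplit.symm, ?_⟩
    rw [integral_congr_ae hsplit, integral_add i1 i2, e1, e2, signMean_insert hi]
    ring

end SignMean

/-! ### Small ball probability -/

section SmallBall

variable {ι : Type*} [DecidableEq ι] {a : ι → ℝ} {T : Finset ι}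

/-- The reflection principle: reflecting the walk `w, w + a i * ε i, …` at its first passage above
`h = (x - β + b / 2) / 2`, where it overshoots by less than `β`, maps the paths ending in
`[x, x + b]` to paths ending in `[-(β + b / 2), β + b / 2]`. -/
lemma signMean_window_le {b β : ℝ} (hβ : b / 2 ≤ β) (hb : 0 < b)
    (ha : ∀ i ∈ T, 0 ≤ a i ∧ a i ≤ β) {x : ℝ} (hx : 0 ≤ x) {w : ℝ}
    (hw : w < (x - β + b / 2) / 2 + β) :
    signMean a T ((Set.Icc x (x + b)).indicator 1) w ≤
      signMean a T ((Set.Icc (-(β + b / 2)) (β + b / 2)).indicator 1) w := by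
  induction T using Finset.induction_on generalizing w with
  | empty =>
    simp only [signMean_empty, Set.indicator, Set.mem_Icc, Pi.one_apply]
    split_ifs with h1 h2 <;> try norm_num
    apply h2
    constructor <;> linarith
  | insert i T hi ih =>
    rcases lt_or_ge w ((x - β + b / 2) / 2) with h | h
    · have hai := ha i (Finset.mem_insert_self i T)
      have ha' : ∀ j ∈ T, 0 ≤ a j ∧ a j ≤ β := fun j hj => ha j (Finset.mem_insert_of_mem hj)
      rw [signMean_insert hi, signMean_insert hi]
      have h1 := ih ha' (w := w + a i) (by linarith)
      have h2 := ih ha' (w := w - a i) (by linarith)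
      linarith
    · rw [← signMean_reflect _ (2 * w), show 2 * w - w = w by ring]
      refine signMean_mono (fun t => ?_) w
      simp only [Set.indicator, Set.mem_Icc, Pi.one_apply]
      split_ifs with h1 h2 <;> try norm_num
      apply h2
      constructor <;> linarith [h1.1, h1.2]

/-- A sign average puts mass `3 / 4` on `[-2, 2]` by Chebyshev's inequality; covering this by
windows of length `b`, each no likelier than the central one, bounds the latter from below. -/
lemma le_signMean_central {b β : ℝ} (hβ : b / 2 ≤ β) (hb : 0 < b) (hb1 : b ≤ 1)
    (ha : ∀ i ∈ T, 0 ≤ a i ∧ a i ≤ β) (hv : ∑ i ∈ T, a i ^ 2 ≤ 1) :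
    b / 12 ≤ signMean a T ((Set.Icc (-(β + b / 2)) (β + b / 2)).indicator 1) 0 := by
  set p := signMean a T ((Set.Icc (-(β + b / 2)) (β + b / 2)).indicator 1) 0 with hp
  set K := ⌈2 / b⌉₊ with hK
  have hK1 : 2 ≤ K * b := (div_le_iff₀ hb).1 (Nat.le_ceil (2 / b))
  have hK2 : K * b ≤ 3 := by
    have h := (Nat.ceil_lt_add_one (div_nonneg zero_le_two hb.le : (0 : ℝ) ≤ 2 / b)).le
    have h' := mul_le_mul_of_nonneg_right h hb.le
    rw [add_mul, div_mul_cancel₀ _ hb.ne'] at h'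
    linarith
  let F : ℕ → ℝ → ℝ := fun k => (Set.Icc (k * b : ℝ) (k * b + b)).indicator 1
  have hF0 : ∀ k t, 0 ≤ F k t := fun k t => Set.indicator_nonneg (fun _ _ => zero_le_one) t
  have hF1 : ∀ k, signMean a T (F k) 0 ≤ p := fun k =>
    signMean_window_le hβ hb ha (by positivity)
      (by have : (0 : ℝ) ≤ k * b := by positivity
          linarith)
  have hcover : ∀ t : ℝ, 0 ≤ t → t ≤ K * b → 1 ≤ ∑ k ∈ Finset.range (K + 1), F k t := by
    intro t ht0 htK
    have h1 : ⌊t / b⌋₊ ∈ Finset.range (K + 1) := by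
      rw [Finset.mem_range, Nat.lt_succ_iff]
      exact Nat.floor_le_of_le ((div_le_iff₀ hb).2 htK)
    refine le_trans ?_ (Finset.single_le_sum (fun k _ => hF0 k t) h1)
    have h2 : (⌊t / b⌋₊ : ℝ) * b ≤ t :=
      (le_div_iff₀ hb).1 (Nat.floor_le (div_nonneg ht0 hb.le))
    have h3 : t ≤ ⌊t / b⌋₊ * b + b := by
      have := ((div_lt_iff₀ hb).1 (Nat.lt_floor_add_one (t / b))).le
      linarith
    simp [F, h2, h3]
  have hpt : ∀ t : ℝ, 1 + (-(1 / 4)) * t ^ 2 ≤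
      ∑ k ∈ Finset.range (K + 1), (F k t + F k (0 - t)) := by
    intro t
    have hn : 0 ≤ ∑ k ∈ Finset.range (K + 1), F k t := Finset.sum_nonneg fun k _ => hF0 k t
    have hn' : 0 ≤ ∑ k ∈ Finset.range (K + 1), F k (0 - t) :=
      Finset.sum_nonneg fun k _ => hF0 k _
    rw [Finset.sum_add_distrib]
    rcases le_or_gt |t| 2 with h | h
    · have hsq : 0 ≤ t ^ 2 := sq_nonneg t
      rcases le_total 0 t with h0 | h0
      · have := hcover t h0 (by linarith [abs_of_nonneg h0])
        linarith
      · have := hcover (0 - t) (by linarith) (by linarith [abs_of_nonpos h0])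
        linarith
    · have : 2 ^ 2 ≤ |t| ^ 2 := by gcongr
      rw [sq_abs] at this
      linarith
  have h := signMean_mono (a := a) (T := T) hpt 0
  rw [signMean_add, signMean_const, signMean_const_mul, signMean_sq, signMean_sum] at h
  have h2 : ∑ k ∈ Finset.range (K + 1), signMean a T (fun t => F k t + F k (0 - t)) 0 ≤
      ∑ k ∈ Finset.range (K + 1), (p + p) := by
    refine Finset.sum_le_sum fun k _ => ?_
    rw [signMean_add]
    have := signMean_reflect (a := a) (T := T) (F k) 0 0
    rw [sub_zero] at this
    rw [this]
    exact add_le_add (hF1 k) (hF1 k)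
  rw [Finset.sum_const, Finset.card_range, nsmul_eq_mul] at h2
  push_cast at h2
  have h3 : 3 / 4 ≤ (K + 1 : ℝ) * (p + p) := by linarith
  have h4 : (K + 1 : ℝ) * b ≤ 4 := by linarith
  have hp0 : 0 ≤ p := by
    by_contra! hneg
    have : (K + 1 : ℝ) * (p + p) ≤ 0 :=
      mul_nonpos_of_nonneg_of_nonpos (by positivity) (by linarith)
    linarith
  nlinarith [mul_le_mul_of_nonneg_right h4 hp0]

/-- A sum of signs with coefficients at most `b` and variance at most `1` lies in `[-b, b]` with
probability at least a constant times `b`. -/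
lemma le_signMean_ball {b : ℝ} (hb : 0 < b) (hb1 : b ≤ 1)
    (ha : ∀ i ∈ T, 0 ≤ a i ∧ a i ≤ b) (hv : ∑ i ∈ T, a i ^ 2 ≤ 1) :
    b / 24 ≤ signMean a T ((Set.Icc (-b) b).indicator 1) 0 := by
  by_cases hsmall : ∀ i ∈ T, a i ≤ b / 2
  · have := le_signMean_central le_rfl hb hb1 (fun i hi => ⟨(ha i hi).1, hsmall i hi⟩) hv
    rw [add_halves] at this
    linarith
  -- If some `a i > b / 2`, the other terms land in `[-3b/2, 3b/2]`, and the right sign of `ε i`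
  -- then brings the sum into `[-b, b]`.
  · push Not at hsmall
    obtain ⟨i, hi, hbi⟩ := hsmall
    have hib := (ha i hi).2
    obtain ⟨T, hiT, rfl⟩ : ∃ T', i ∉ T' ∧ T = insert i T' :=
      ⟨T.erase i, Finset.notMem_erase i T, (Finset.insert_erase hi).symm⟩
    rw [Finset.sum_insert hiT] at hv
    have h := le_signMean_central (β := b) (by linarith) hb hb1
      (fun j hj => ha j (Finset.mem_insert_of_mem hj)) (by linarith [sq_nonneg (a i)])
    rw [signMean_insert hiT, sub_eq_add_neg, add_comm 0 (a i), add_comm 0 (-a i),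
      ← signMean_translate, ← signMean_translate, ← signMean_add]
    have h' := signMean_mono (a := a) (T := T)
      (f := (Set.Icc (-(b + b / 2)) (b + b / 2)).indicator 1)
      (g := fun t => (Set.Icc (-b) b).indicator 1 (a i + t) +
        (Set.Icc (-b) b).indicator 1 (-a i + t)) (fun t => ?_) 0
    · linarith
    · have hn : ∀ s : ℝ, 0 ≤ (Set.Icc (-b) b).indicator (1 : ℝ → ℝ) s := fun s =>
        Set.indicator_nonneg (fun _ _ => zero_le_one) s
      by_cases ht : t ∈ Set.Icc (-(b + b / 2)) (b + b / 2)
      · rw [Set.indicator_of_mem ht, Pi.one_apply]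
        rcases le_total 0 t with h0 | h0
        · have : -a i + t ∈ Set.Icc (-b) b := ⟨by linarith, by linarith [ht.2]⟩
          rw [Set.indicator_of_mem this, Pi.one_apply]
          linarith [hn (a i + t)]
        · have : a i + t ∈ Set.Icc (-b) b := ⟨by linarith [ht.1], by linarith⟩
          rw [Set.indicator_of_mem this, Pi.one_apply]
          linarith [hn (-a i + t)]
      · rw [Set.indicator_of_notMem ht]
        exact add_nonneg (hn _) (hn _)

end SmallBall

/-! ### Averaging two squared coefficients -/

/-- The dependence on `u` of the symmetrized cube is carried by `|t| u²` and a truncated cube. -/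
lemma abs_cube_symm {u : ℝ} (hu : 0 ≤ u) (t : ℝ) :
    |u + t| ^ 3 + |u - t| ^ 3 =
      2 * (|t| ^ 3 + 3 * |t| * u ^ 2 + max (u - |t|) 0 ^ 3) := by
  have key : ∀ y : ℝ, 0 ≤ y → |u + y| ^ 3 + |u - y| ^ 3 =
      2 * (y ^ 3 + 3 * y * u ^ 2 + max (u - y) 0 ^ 3) := by
    intro y hy
    rw [abs_of_nonneg (add_nonneg hu hy)]
    rcases le_total y u with h | h
    · rw [abs_of_nonneg (sub_nonneg.2 h), max_eq_left (sub_nonneg.2 h)]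
      ring
    · rw [abs_of_nonpos (sub_nonpos.2 h), max_eq_right (sub_nonpos.2 h)]
      ring
  rcases le_total 0 t with h | h
  · rw [abs_of_nonneg h]
    exact key t h
  · rw [abs_of_nonpos h, ← key (-t) (neg_nonneg.2 h)]
    ring_nf

/-- For `w² = u² + v²`, the gap `(w - y)³ - (u - y)³ - (v - y)³` decreases in `y` on `[0, v]`. -/
lemma cube_gap_le {u v w y : ℝ} (hv : 0 ≤ v) (hvu : v ≤ u) (hw : 0 ≤ w)
    (hsq : w ^ 2 = u ^ 2 + v ^ 2) (hy : 0 ≤ y) (hyv : y ≤ v) :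
    (w - v) ^ 3 - (u - v) ^ 3 ≤ (w - y) ^ 3 - (u - y) ^ 3 - (v - y) ^ 3 := by
  have hwu : u ≤ w := by nlinarith [sq_nonneg v]
  obtain ⟨θ, rfl⟩ : ∃ θ, w = u + θ := ⟨w - u, by ring⟩
  obtain ⟨δ, rfl⟩ : ∃ δ, y = v - δ := ⟨v - y, by ring⟩
  have hθ : 0 ≤ θ := by linarith
  have hθv : 2 * θ ≤ v := by
    rcases hv.eq_or_lt with rfl | hv0
    · nlinarith
    · by_contra! h
      nlinarith
  have hid : (u + θ - (v - δ)) ^ 3 - (u - (v - δ)) ^ 3 - (v - (v - δ)) ^ 3 -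
      ((u + θ - v) ^ 3 - (u - v) ^ 3) =
      δ * (3 * v * (v - 2 * θ) + 3 * δ * θ - δ ^ 2) := by
    linear_combination 3 * δ * hsq
  have hpos : 0 ≤ 3 * v * (v - 2 * θ) + 3 * δ * θ - δ ^ 2 := by
    have hδ : 0 ≤ δ := by linarith
    have hδv : δ ≤ v := by linarith
    nlinarith [mul_nonneg hδ hθ, mul_nonneg hv (sub_nonneg.2 hθv),
      mul_nonneg (sub_nonneg.2 hδv) (sub_nonneg.2 hθv), mul_nonneg hδ (sub_nonneg.2 hδv),
      mul_nonneg hδ (sub_nonneg.2 hθv)]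
  have : 0 ≤ δ * (3 * v * (v - 2 * θ) + 3 * δ * θ - δ ^ 2) := mul_nonneg (by linarith) hpos
  linarith

lemma posPart_cube_add_le {u v w y : ℝ} (hv : 0 ≤ v) (hvu : v ≤ u) (hw : 0 ≤ w)
    (hsq : w ^ 2 = u ^ 2 + v ^ 2) (hy : 0 ≤ y) :
    max (u - y) 0 ^ 3 + max (v - y) 0 ^ 3 ≤ max (w - y) 0 ^ 3 := by
  have hwu : u ≤ w := by nlinarith [sq_nonneg v]
  rcases le_total y v with h | h
  · rw [max_eq_left (by linarith : 0 ≤ u - y), max_eq_left (by linarith : 0 ≤ v - y),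
      max_eq_left (by linarith : 0 ≤ w - y)]
    have h1 := cube_gap_le hv hvu hw hsq hy h
    have h2 : (u - v) ^ 3 ≤ (w - v) ^ 3 := by
      have : 0 ≤ u - v := by linarith
      gcongr
    linarith
  · rw [max_eq_right (by linarith : v - y ≤ 0)]
    have : max (u - y) 0 ^ 3 ≤ max (w - y) 0 ^ 3 := by
      gcongr
    simpa using this

/-- On the range `|y| ≤ w / √2` the truncated cubes are superadditive with a definite gain. -/
lemma posPart_cube_gap {u v w y : ℝ} (hv : 0 ≤ v) (hvu : v ≤ u) (hw : 0 < w)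
    (hsq : w ^ 2 = u ^ 2 + v ^ 2) (hy : 0 ≤ y) (hyw : 2 * y ^ 2 ≤ w ^ 2) :
    u ^ 2 * v ^ 2 / (25 * w) ≤
      max (w - y) 0 ^ 3 - max (u - y) 0 ^ 3 - max (v - y) 0 ^ 3 := by
  have hwu : u ≤ w := by nlinarith [sq_nonneg v]
  have key : ∀ z : ℝ, 0 ≤ z → 2 * z ^ 2 ≤ w ^ 2 →
      u ^ 2 * v ^ 2 / (25 * w) ≤ (w - z) ^ 3 - (u - z) ^ 3 := by
    intro z hz hzw
    have hzu : z ≤ u := by nlinarith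
    -- `z ≤ w / √2`, with a rational upper bound for `1 / √2`.
    have hz' : z ≤ 0.7072 * w := by
      by_contra! h
      nlinarith
    have h1 : (w - u) * (w - z) ^ 2 ≤ (w - z) ^ 3 - (u - z) ^ 3 := by
      have hid : (w - z) ^ 3 - (u - z) ^ 3 = (w - u) *
        ((w - z) ^ 2 + (w - z) * (u - z) + (u - z) ^ 2) := by ring
      rw [hid]
      refine mul_le_mul_of_nonneg_left ?_ (sub_nonneg.2 hwu)
      have := mul_nonneg (by linarith : 0 ≤ w - z) (sub_nonneg.2 hzu)
      linarith [sq_nonneg (u - z)]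
    have h2 : (0.2928 * w) ^ 2 ≤ (w - z) ^ 2 := by
      have : 0 ≤ 0.2928 * w := by positivity
      gcongr
      linarith
    have h3 : v ^ 2 ≤ (w - u) * (2 * w) := by nlinarith
    have h4 : u ^ 2 ≤ w ^ 2 := by linarith [sq_nonneg v]
    rw [div_le_iff₀ (by positivity)]
    calc u ^ 2 * v ^ 2 ≤ w ^ 2 * ((w - u) * (2 * w)) := by gcongr
      _ ≤ (w - u) * (0.2928 * w) ^ 2 * (25 * w) := by
        nlinarith [mul_nonneg (sub_nonneg.2 hwu) (pow_pos hw 3).le]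
      _ ≤ (w - u) * (w - z) ^ 2 * (25 * w) := by
        have := sub_nonneg.2 hwu
        gcongr
      _ ≤ ((w - z) ^ 3 - (u - z) ^ 3) * (25 * w) := by gcongr
  have hyu : y ≤ u := by nlinarith
  rw [max_eq_left (by linarith : 0 ≤ u - y), max_eq_left (by linarith : 0 ≤ w - y)]
  rcases le_total y v with h | h
  · rw [max_eq_left (by linarith : 0 ≤ v - y)]
    exact (key v hv (by nlinarith)).trans (cube_gap_le hv hvu hw.le hsq hy h)
  · rw [max_eq_right (by linarith : v - y ≤ 0)]
    simpa using key y hy hyw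

section Averaging

variable {ι : Type*} [DecidableEq ι] {a : ι → ℝ} {T : Finset ι}

/-- The third absolute moment, after splitting off the coefficients `a i` and `a j`. -/
lemma signMean_insert_insert_cube {i j : ι} (hij : i ≠ j) (hi : i ∉ T) (hj : j ∉ T)
    (h0 : 0 ≤ a j) (hle : a j ≤ a i) :
    signMean a (insert i (insert j T)) (fun t => |t| ^ 3) 0 =
      signMean a T (fun t => |t| ^ 3 + 3 * (a i ^ 2 + a j ^ 2) * |t| +
        (1 / 2) * (max (a i + a j - |t|) 0 ^ 3 + max (a i - a j - |t|) 0 ^ 3)) 0 := by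
  have hsymm : ∀ u : ℝ, 0 ≤ u → signMean a T (fun t => |t| ^ 3) u +
      signMean a T (fun t => |t| ^ 3) (-u) =
      signMean a T (fun t => 2 * (|t| ^ 3 + 3 * |t| * u ^ 2 + max (u - |t|) 0 ^ 3)) 0 := by
    intro u hu
    simp only [← abs_cube_symm hu]
    rw [signMean_add (fun t => |u + t| ^ 3) (fun t => |u - t| ^ 3),
      signMean_translate (fun t => |t| ^ 3) u 0, add_zero, ← signMean_reflect _ 0 (-u)]
    have h := signMean_reflect (a := a) (T := T) (fun t => |u - t| ^ 3) 0 0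
    rw [sub_zero] at h
    rw [← h]
    have h' := signMean_translate (a := a) (T := T) (fun t => |0 - t| ^ 3) u 0
    rw [add_zero] at h'
    rw [show (0 : ℝ) - -u = u by ring, ← h']
    simp only [zero_sub, abs_neg, sub_neg_eq_add]
  have hu := hsymm (a i + a j) (by linarith)
  have hv := hsymm (a i - a j) (by linarith)
  have hi' : i ∉ insert j T := by simp [hij, hi]
  rw [signMean_insert hi', signMean_insert hj, signMean_insert hj,
    show 0 + a i + a j = a i + a j by ring, show 0 + a i - a j = a i - a j by ring,
    show 0 - a i + a j = -(a i - a j) by ring, show 0 - a i - a j = -(a i + a j) by ring]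
  calc _ = (1 / 4) * (signMean a T (fun t => |t| ^ 3) (a i + a j) +
          signMean a T (fun t => |t| ^ 3) (-(a i + a j)) +
        (signMean a T (fun t => |t| ^ 3) (a i - a j) +
          signMean a T (fun t => |t| ^ 3) (-(a i - a j)))) := by ring
    _ = _ := by
      rw [hu, hv, ← signMean_add, ← signMean_const_mul]
      congr 1
      funext t
      ring

/-- Replacing the two squares `a i ^ 2`, `a j ^ 2`, where `a i` dominates all coefficients, by their
average increases the third absolute moment by a multiple of `(a i ^ 2 - a j ^ 2) ^ 2`. -/
lemma signMean_cube_average {i j : ι} (hij : i ≠ j) (hi : i ∉ T) (hj : j ∉ T) (h0 : 0 ≤ a j)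
    (hle : a j ≤ a i) (hi0 : 0 < a i) (ha : ∀ k ∈ T, 0 ≤ a k ∧ a k ≤ a i)
    (hv : a i ^ 2 + a j ^ 2 + ∑ k ∈ T, a k ^ 2 = 1) {a' : ι → ℝ}
    (hT : ∀ k ∈ T, a' k = a k) (hi' : a' i = √((a i ^ 2 + a j ^ 2) / 2))
    (hj' : a' j = √((a i ^ 2 + a j ^ 2) / 2)) :
    signMean a (insert i (insert j T)) (fun t => |t| ^ 3) 0 + (a i ^ 2 - a j ^ 2) ^ 2 / 1700 ≤
      signMean a' (insert i (insert j T)) (fun t => |t| ^ 3) 0 := by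
  rw [signMean_insert_insert_cube hij hi hj h0 hle, signMean_insert_insert_cube hij hi hj
    (by rw [hj']; positivity) (by rw [hi', hj']), signMean_congr hT]
  set s := a i ^ 2 + a j ^ 2 with hs
  have hs0 : 0 < s := by positivity
  have hs2 : √(s / 2) ^ 2 = s / 2 := Real.sq_sqrt (by positivity)
  set w := a' i + a' j with hw
  have hw2 : w ^ 2 = (a i + a j) ^ 2 + (a i - a j) ^ 2 := by
    rw [hw, hi', hj', ← two_mul, mul_pow, hs2, hs]
    ring
  have hw0 : 0 < w := by
    rw [hw, hi', hj']
    positivity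
  have hsum : a' i ^ 2 + a' j ^ 2 = s := by rw [hi', hj', hs2, add_halves]
  have hdiff : a' i - a' j = 0 := by rw [hi', hj', sub_self]
  rw [hsum, hdiff]
  -- The small ball of radius `√s = w / √2` dominates every remaining coefficient.
  set b := √s with hb
  have hb2 : b ^ 2 = s := Real.sq_sqrt hs0.le
  have hb0 : 0 < b := Real.sqrt_pos.2 hs0
  have hwb : w ^ 2 = 2 * b ^ 2 := by rw [hw2, hb2, hs]; ring
  have hnn : 0 ≤ ∑ k ∈ T, a k ^ 2 := Finset.sum_nonneg fun k _ => sq_nonneg _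
  have hball := le_signMean_ball (a := a) (T := T) hb0 (by nlinarith)
    (fun k hk => ⟨(ha k hk).1, (ha k hk).2.trans (Real.le_sqrt_of_sq_le (by
      linarith [sq_nonneg (a j)]))⟩) (by linarith)
  set c := (a i + a j) ^ 2 * (a i - a j) ^ 2 / (25 * w) with hc
  have hc0 : 0 ≤ c := by positivity
  have hpt : ∀ t : ℝ, (|t| ^ 3 + 3 * s * |t| +
      (1 / 2) * (max (a i + a j - |t|) 0 ^ 3 + max (a i - a j - |t|) 0 ^ 3)) +
        (c / 2) * (Set.Icc (-b) b).indicator 1 t ≤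
      |t| ^ 3 + 3 * s * |t| + (1 / 2) * (max (w - |t|) 0 ^ 3 + max (0 - |t|) 0 ^ 3) := by
    intro t
    rw [max_eq_right (by linarith [abs_nonneg t] : 0 - |t| ≤ 0)]
    by_cases ht : t ∈ Set.Icc (-b) b
    · have h1 : |t| ≤ b := abs_le.2 ht
      have h2 : |t| ^ 2 ≤ b ^ 2 := by gcongr
      have := posPart_cube_gap (by linarith) (by linarith) hw0 hw2 (abs_nonneg t) (by linarith)
      rw [Set.indicator_of_mem ht, Pi.one_apply]
      linarith
    · have := posPart_cube_add_le (by linarith) (by linarith) hw0.le hw2 (abs_nonneg t)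
      rw [Set.indicator_of_notMem ht]
      linarith
  have h := signMean_mono (a := a) (T := T) hpt 0
  rw [signMean_add _ (fun t => (c / 2) * (Set.Icc (-b) b).indicator 1 t),
    signMean_const_mul] at h
  refine le_trans (add_le_add le_rfl ?_) h
  refine le_trans ?_ (mul_le_mul_of_nonneg_left hball (by positivity))
  -- `w = √2 * b`, with a rational upper bound for `√2`.
  have hwb' : w ≤ 1.4143 * b := by
    by_contra! hcon
    nlinarith
  have hprod : (a i + a j) ^ 2 * (a i - a j) ^ 2 = (a i ^ 2 - a j ^ 2) ^ 2 := by ring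
  rw [hc, hprod]
  have hE : (a i ^ 2 - a j ^ 2) ^ 2 / (25 * w) / 2 * (b / 24) =
      (a i ^ 2 - a j ^ 2) ^ 2 * (b / (1200 * w)) := by
    field_simp
    ring
  rw [hE, div_eq_mul_inv]
  refine mul_le_mul_of_nonneg_left ?_ (sq_nonneg _)
  rw [le_div_iff₀ (by positivity)]
  linarith

end Averaging

/-! ### The maximizer on the simplex -/

/-- Among vectors of squares `x` summing to `1`, the third moment improved by `∑ i, x i ^ 2 / 1000`
is largest at the constant vector. -/
lemma signMean_cube_add_le {n : ℕ} [NeZero n] {x : Fin n → ℝ} (hx : ∀ i, 0 ≤ x i)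
    (hsum : ∑ i, x i = 1) :
    signMean (fun i => √(x i)) Finset.univ (fun t => |t| ^ 3) 0 + (∑ i, x i ^ 2) / 1000 ≤
      signMean (fun _ : Fin n => √(1 / n)) Finset.univ (fun t => |t| ^ 3) 0 +
        (1 / n : ℝ) / 1000 := by
  set G : (Fin n → ℝ) → ℝ := fun x =>
    signMean (fun i => √(x i)) Finset.univ (fun t => |t| ^ 3) 0 + (∑ i, x i ^ 2) / 1000 with hG
  have hn : (n : ℝ) ≠ 0 := Nat.cast_ne_zero.2 (NeZero.ne n)
  have hcont : Continuous G := by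
    simp only [hG, signMean]
    fun_prop
  obtain ⟨z, hz, hmax⟩ := (isCompact_stdSimplex ℝ (Fin n)).exists_isMaxOn ⟨x, hx, hsum⟩
    hcont.continuousOn
  obtain ⟨i, hi⟩ := Finite.exists_max z
  obtain ⟨j, hj⟩ := Finite.exists_min z
  have hij : z i = z j := by
    by_contra hne
    have hne' : i ≠ j := fun h => hne (by rw [h])
    have hlt : z j < z i := lt_of_le_of_ne (hi j) (Ne.symm hne)
    have hj0 : 0 ≤ z j := hz.1 j
    have hi0 : 0 < z i := hj0.trans_lt hlt
    set T : Finset (Fin n) := (Finset.univ.erase i).erase j with hT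
    have hjT : j ∉ T := Finset.notMem_erase j _
    have hiT : i ∉ T := fun h => Finset.notMem_erase i _ (Finset.mem_of_mem_erase h)
    have hiT' : i ∉ insert j T := by simp [hne', hiT]
    have huniv : insert i (insert j T) = Finset.univ := by
      rw [hT, Finset.insert_erase (by simp [hne'.symm]), Finset.insert_erase (Finset.mem_univ i)]
    have hsplit : ∀ f : Fin n → ℝ, ∑ k, f k = f i + (f j + ∑ k ∈ T, f k) := fun f => by
      rw [← huniv, Finset.sum_insert hiT', Finset.sum_insert hjT]
    set y : Fin n → ℝ := fun k => if k ∈ T then z k else (z i + z j) / 2 with hy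
    have hyT : ∀ k ∈ T, y k = z k := fun k hk => if_pos hk
    have hyi : y i = (z i + z j) / 2 := if_neg hiT
    have hyj : y j = (z i + z j) / 2 := if_neg hjT
    have hymem : y ∈ stdSimplex ℝ (Fin n) := by
      refine ⟨fun k => ?_, ?_⟩
      · by_cases hk : k ∈ T
        · rw [hyT k hk]
          exact hz.1 k
        · rw [hy]
          simp only [hk, if_false]
          linarith
      · rw [hsplit, hyi, hyj, Finset.sum_congr rfl hyT, ← hz.2, hsplit z]
        ring
    have hzi : √(z i) ^ 2 = z i := Real.sq_sqrt hi0.le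
    have hzj : √(z j) ^ 2 = z j := Real.sq_sqrt hj0
    have hgain := signMean_cube_average (a := fun k => √(z k)) (a' := fun k => √(y k)) hne' hiT hjT
      (Real.sqrt_nonneg _) (Real.sqrt_le_sqrt (hi j)) (Real.sqrt_pos.2 hi0)
      (fun k _ => ⟨Real.sqrt_nonneg _, Real.sqrt_le_sqrt (hi k)⟩)
      (by
        rw [← hz.2, hsplit z, Finset.sum_congr rfl fun k _ => Real.sq_sqrt (hz.1 k), hzi, hzj]
        ring)
      (fun k hk => by simp only [hyT k hk]) (by simp only [hyi, hzi, hzj])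
      (by simp only [hyj, hzi, hzj])
    rw [huniv, hzi, hzj] at hgain
    have hle : G y ≤ G z := hmax hymem
    have hsq : ∑ k, z k ^ 2 = ∑ k, y k ^ 2 + (z i - z j) ^ 2 / 2 := by
      rw [hsplit, hsplit fun k => y k ^ 2, hyi, hyj,
        Finset.sum_congr rfl fun k hk => by rw [← hyT k hk]]
      ring
    have hpos : 0 < (z i - z j) ^ 2 := pow_pos (sub_pos.2 hlt) 2
    simp only [hG] at hle
    linarith
  have hconst : ∀ k, z k = 1 / n := by
    have h : ∀ k, z k = z i := fun k => le_antisymm (hi k) (hij ▸ hj k)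
    have h1 := hz.2
    rw [Finset.sum_congr rfl fun k _ => h k] at h1
    simp only [Finset.sum_const, Finset.card_univ, Fintype.card_fin, nsmul_eq_mul] at h1
    intro k
    rw [h k, eq_div_iff hn, mul_comm, h1]
  obtain rfl : z = fun _ => 1 / (n : ℝ) := funext hconst
  have h : G x ≤ G fun _ => 1 / (n : ℝ) := hmax ⟨hx, hsum⟩
  simp only [hG, Finset.sum_const, Finset.card_univ, Fintype.card_fin, nsmul_eq_mul] at h
  rwa [show (n : ℝ) * (1 / n) ^ 2 = 1 / n by field_simp] at h

/-- The deficit is at most the squared distance of the squares `a i ^ 2` from their mean. -/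
lemma criticalDeficit_le {n : ℕ} [NeZero n] {a : Fin n → ℝ} (ha : Antitone a)
    (h0 : ∀ i, 0 ≤ a i) (hsum : ∑ i, a i ^ 2 = 1) :
    criticalDeficit a ≤ ∑ i, (a i ^ 2 - 1 / n) ^ 2 := by
  have hn : (0 : ℝ) < n := Nat.cast_pos.2 (NeZero.pos n)
  have hmono : ∀ i j, i ≤ j → a j ^ 2 ≤ a i ^ 2 := fun i j h => by
    have := h0 j
    have := ha h
    gcongr
  have hlast : a (Fin.rev 0) ^ 2 ≤ 1 / n := by
    have h : ∑ _i : Fin n, a (Fin.rev 0) ^ 2 ≤ ∑ i, a i ^ 2 :=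
      Finset.sum_le_sum fun i _ => hmono i _ (Fin.le_rev_iff.2 (Fin.zero_le _))
    rw [hsum, Finset.sum_const, Finset.card_univ, Fintype.card_fin, nsmul_eq_mul] at h
    rwa [le_div_iff₀ hn, mul_comm]
  have hM : 0 < a 0 ^ 2 + 1 / (n : ℝ) := by positivity
  -- By the inequality of means, the square root is at most the normalizing factor.
  have hsqrt : ∀ i, √(1 / n * (a i ^ 2 + a (Fin.rev 0) ^ 2 - 1 / n)) ≤ a 0 ^ 2 + 1 / n := by
    intro i
    have hi := hmono 0 i (Fin.zero_le i)
    have hinv : (0 : ℝ) < 1 / n := by positivity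
    refine Real.sqrt_le_iff.2 ⟨hM.le, ?_⟩
    calc 1 / n * (a i ^ 2 + a (Fin.rev 0) ^ 2 - 1 / n) ≤ 1 / n * a 0 ^ 2 := by
          gcongr
          linarith
      _ ≤ (a 0 ^ 2 + 1 / n) ^ 2 := by
          nlinarith [mul_nonneg hinv.le (sq_nonneg (a 0)), sq_nonneg (a 0 ^ 2)]
  have hpos : ∀ u : ℝ, max u 0 ^ 2 ≤ u ^ 2 := fun u => by
    rcases le_total 0 u with h | h
    · rw [max_eq_left h]
    · rw [max_eq_right h, zero_pow two_ne_zero]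
      exact sq_nonneg u
  have hterm : ∀ i, √(1 / n * (a i ^ 2 + a (Fin.rev 0) ^ 2 - 1 / n)) *
      max (a i ^ 2 - 1 / n) 0 * max (1 / n - a (Fin.rev i) ^ 2) 0 ≤
      (a 0 ^ 2 + 1 / n) *
        (((a i ^ 2 - 1 / n) ^ 2 + (a (Fin.rev i) ^ 2 - 1 / n) ^ 2) / 2) := by
    intro i
    rw [mul_assoc]
    refine mul_le_mul (hsqrt i) ?_ (by positivity) hM.le
    have h1 := hpos (a i ^ 2 - 1 / n)
    have h2 := hpos (1 / n - a (Fin.rev i) ^ 2)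
    have h3 := two_mul_le_add_sq (max (a i ^ 2 - 1 / n) 0) (max (1 / n - a (Fin.rev i) ^ 2) 0)
    linarith
  have hrev : ∑ i : Fin n, (a (Fin.rev i) ^ 2 - 1 / (n : ℝ)) ^ 2 =
      ∑ i, (a i ^ 2 - 1 / (n : ℝ)) ^ 2 :=
    Equiv.sum_comp Fin.revPerm fun i => (a i ^ 2 - 1 / (n : ℝ)) ^ 2
  rw [criticalDeficit, one_div, inv_mul_le_iff₀ hM]
  refine (Finset.sum_le_sum fun i _ => hterm i).trans_eq ?_
  rw [← Finset.mul_sum, ← Finset.sum_div, Finset.sum_add_distrib, hrev, add_self_div_two]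

theorem mainTheorem3 :
    ∃ C : ℝ, 0 < C ∧
      ∀ (n : ℕ) [NeZero n] (a : Fin n → ℝ),
        Antitone a → (∀ i, 0 ≤ a i) → ∑ i, a i ^ 2 = 1 →
        ∀ {Ω : Type*} [MeasurableSpace Ω] (P : Measure Ω) [IsProbabilityMeasure P]
          (ε : Fin n → Ω → ℝ),
          (∀ i, IsRademacher (ε i) P) → iIndepFun ε P →
          ∫ ω, |rademacherSum a ε ω| ^ 3 ∂P ≤
            ∫ ω, |diagonalSum ε ω| ^ 3 ∂P - C * criticalDeficit a := by
  refine ⟨1 / 1000, by norm_num, ?_⟩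
  intro n _ a ha h0 hsum Ω _ P _ ε hε hind
  have hf : Measurable fun t : ℝ => |t| ^ 3 := by fun_prop
  have hn : (n : ℝ) ≠ 0 := Nat.cast_ne_zero.2 (NeZero.ne n)
  have hS : ∫ ω, |rademacherSum a ε ω| ^ 3 ∂P =
      signMean (fun i => √(a i ^ 2)) Finset.univ (fun t => |t| ^ 3) 0 := by
    have h := (integral_rademacher hε hind a Finset.univ hf 0).2
    simp only [zero_add] at h
    simp only [rademacherSum, h, Real.sqrt_sq (h0 _)]
  have hD : ∫ ω, |diagonalSum ε ω| ^ 3 ∂P =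
      signMean (fun _ : Fin n => √(1 / n)) Finset.univ (fun t => |t| ^ 3) 0 := by
    have h := (integral_rademacher hε hind (fun _ => √(1 / n)) Finset.univ hf 0).2
    simp only [zero_add, ← Finset.mul_sum] at h
    rw [← h]
    simp only [diagonalSum, Real.sqrt_div zero_le_one, Real.sqrt_one]
  have hmain := signMean_cube_add_le (fun i => sq_nonneg (a i)) hsum
  have hvar : ∑ i, (a i ^ 2 - 1 / (n : ℝ)) ^ 2 = ∑ i, (a i ^ 2) ^ 2 - 1 / n := by
    simp only [sub_sq, Finset.sum_add_distrib, Finset.sum_sub_distrib, ← Finset.sum_mul,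
      ← Finset.mul_sum, hsum, Finset.sum_const, Finset.card_univ, Fintype.card_fin, nsmul_eq_mul]
    field_simp
    ring
  have hdef := criticalDeficit_le ha h0 hsum
  rw [hS, hD]
  linarith
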